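/- For $n\ge 1$, let $\mathcal E_n$ be the elliptope, i.e. the set of positive-semidefinite real $n\times n$ matrices with unit diagonal, and let $\mathcal C_n=\operatorname{conv}\{cc^{\mathsf t}: c\in\{\pm1\}^n\}$ be the cut polytope. A face of a convex set $K$ is a convex subset $F\subseteq K$ such that $x,y\in F$ whenever $x,y\in K$ and $\theta x+(1-\theta)y\in F$ for some $\theta\in(0,1)$. A $k$-dimensional face (dimension of the affine hull) is simplicial if it is the convex hull of an affinely independent family of $k+1$ points. Let $r\ge1$, and let $\xi_1,\dots,\xi_r$ be independent random vectors in $\{\pm1\}^n$, each with independent entries that equal $+1$ or $-1$ with probability $1/2$ each. Put $F=\operatorname{conv}\{\xi_1\xi_1^{\mathsf t},\dots,\xi_r\xi_r^{\mathsf t}\}$. Then $$\mathbb P\{F\text{ is a simplicial face of }\mathcal E_n\text{ of dimension }r-1\}\ \ge\ 1-r^2\exp\!\left(\frac{-n}{r^2}\right).$$ Consequently, let $\mathcal S_{n,r}$ be the set of all sets that are simplicial faces of dimension $r-1$ both of $\mathcal E_n$ and of $\mathcal C_n$. Then: 1. $\mathbb P\{F\in\mathcal S_{n,r}\}\ge 1-r^2\exp(-n/r^2)$.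 This probability is positive when $r^2\log r^2<n$, and also when $n\ge2$ and $r\le\sqrt{n/\log n}$. 2. $\mathcal S_{n,r}$ is finite, and $$\#\mathcal S_{n,r}\ \ge\ \left(1-r^2\exp\!\left(\frac{-n}{r^2}\right)\right)\frac{(2^{n-1})^r}{r!}.$$ In particular, if $n\ge2$ and $r\le\sqrt{n/\log n}$, then $$\#\mathcal S_{n,r}\ \ge\ \left(1-\frac1{\log n}\right)\frac{(2^{n-1})^r}{r!}.$$ -/

import Mathlib

open MeasureTheory ProbabilityTheory

noncomputable section

/-- An `n`-dimensional cut vector is an element of `{±1}ⁿ`. -/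
def IsCutVector {n : ℕ} (c : Fin n → ℝ) : Prop :=
  ∀ i, c i = 1 ∨ c i = -1

/-- The matrix `c cᵗ`. -/
def cutMatrix {n : ℕ} (c : Fin n → ℝ) : Matrix (Fin n) (Fin n) ℝ :=
  Matrix.vecMulVec c c

/-- The cut polytope: the convex hull of the `n × n` cut matrices. -/
def cutPolytope (n : ℕ) : Set (Matrix (Fin n) (Fin n) ℝ) :=
  convexHull ℝ {X | ∃ c : Fin n → ℝ, IsCutVector c ∧ X = cutMatrix c}

/-- The elliptope: the positive-semidefinite `n × n` real matrices with unit diagonal. -/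
def elliptope (n : ℕ) : Set (Matrix (Fin n) (Fin n) ℝ) :=
  {X | X.PosSemidef ∧ ∀ i, X i i = 1}

/-- The dimension of a set, namely that of its affine hull. -/
def affineDim {E : Type*} [AddCommGroup E] [Module ℝ E] (F : Set E) : ℕ :=
  Module.finrank ℝ (affineSpan ℝ F).direction

/-- A face of `K`: a convex subset `F` of `K` such that two points of `K` both lie in `F`
as soon as some point strictly between them lies in `F`. -/
structure IsFace {E : Type*} [AddCommGroup E] [Module ℝ E] (K F : Set E) : Prop where
  convex : Convex ℝ F
  subset : F ⊆ K
  extreme : ∀ x ∈ K, ∀ y ∈ K, ∀ θ : ℝ, 0 < θ → θ < 1 →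
    θ • x + (1 - θ) • y ∈ F → x ∈ F ∧ y ∈ F

/-- `F` is a simplicial face of `K` of dimension `k`: a face of dimension `k` that is
the convex hull of an affinely independent family of `k + 1` points. -/
structure IsSimplicialFace {E : Type*} [AddCommGroup E] [Module ℝ E]
    (K F : Set E) (k : ℕ) : Prop where
  isFace : IsFace K F
  dim_eq : affineDim F = k
  simplex : ∃ v : Fin (k + 1) → E, AffineIndependent ℝ v ∧ F = convexHull ℝ (Set.range v)

/-- The sets that are simplicial faces of dimension `k` of the elliptope and of the
cut polytope at the same time. -/
def sharedSimplicialFaces (n k : ℕ) : Set (Set (Matrix (Fin n) (Fin n) ℝ)) :=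
  {F | IsSimplicialFace (elliptope n) F k ∧ IsSimplicialFace (cutPolytope n) F k}

/-- The signed Bernoulli distribution: `+1` with probability `p`, `-1` with probability `1 - p`. -/
def signedBernoulli (p : ℝ) : Measure ℝ :=
  ENNReal.ofReal p • Measure.dirac 1 + ENNReal.ofReal (1 - p) • Measure.dirac (-1)

/-- The law of a random vector with `n` independent signed Bernoulli entries. -/
def signedBernoulliVec (p : ℝ) (n : ℕ) : Measure (Fin n → ℝ) :=
  Measure.pi fun _ => signedBernoulli p

/-- The convex hull of the matrices `c₁ c₁ᵗ, …, c_r c_rᵗ`. -/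
def cutHull {r n : ℕ} (c : Fin r → Fin n → ℝ) : Set (Matrix (Fin n) (Fin n) ℝ) :=
  convexHull ℝ (Set.range fun i => cutMatrix (c i))

/-- `ξ₁, …, ξ_r` are independent random vectors on the probability space `(Ω, μ)`, each with
`n` independent signed Bernoulli entries of parameter `p`; the random set `cutHull ξ` is then
a draw from the random face model with parameters `p, r, n`. -/
structure IsFaceModel {Ω : Type*} [MeasurableSpace Ω] (p : ℝ) (r n : ℕ) (μ : Measure Ω)
    (ξ : Fin r → Ω → Fin n → ℝ) : Prop where
  hasLaw : ∀ i, HasLaw (ξ i) (signedBernoulliVec p n) μ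
  indep : iIndepFun ξ μ

end

/-! Read the sign vectors `c₁, …, c_r` as the `n` points `(c₁ i, …, c_r i)` of `{±1}^r`. General
position means that the values of the monomials `1`, `x_k x_l` (`k < l`) at these points span `ℝ^d`,
where `d = 1 + r(r-1)/2 ≤ r²`.

General position makes the hull a face (`InGeneralPosition.left_mem_cutHull`). Suppose a point of
the hull is interior to a segment of the elliptope with endpoint `X`. Then `X` kills the vectors
orthogonal to all `c_k`, so `X = V M Vᵀ` with columns `c_k` in `V` and `M` positive semidefinite.
The unit diagonal says that the form of `M` is `1` at all `n` points, so `M` is diagonal of trace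
`1` and `X` is a convex combination of the `c_k c_kᵀ`.

General position is likely (`card_span_ne_top_le`): distinct monomials are orthogonal on the cube,
so each further uniform point multiplies the expected codimension of the span by at most `1 - 1/d`.

For the count, a hull determines its family in general position up to order and signs, so at most
`r! 2^r` such families share a face. -/

/-! ### Spanning by random members of an isotropic family. -/

/-- An isotropic finite family of vectors of squared norm `d` meets a subspace `W` of `ℝ^d` in a
proportion at most `dim W / d` of its members. -/
theorem card_mem_submodule_mul_le {A ι : Type*} [Fintype A] [Fintype ι]
    (y : A → EuclideanSpace ℝ ι)
    (hiso : ∀ v, ∑ a, (inner ℝ v (y a)) ^ 2 = Fintype.card A * ‖v‖ ^ 2)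
    (hnorm : ∀ a, ‖y a‖ ^ 2 = Fintype.card ι) (W : Submodule ℝ (EuclideanSpace ℝ ι))
    [DecidablePred fun a => y a ∈ W] :
    ((Finset.univ.filter fun a => y a ∈ W).card : ℝ) * Fintype.card ι ≤
      Fintype.card A * Module.finrank ℝ W := by
  set b := stdOrthonormalBasis ℝ W
  -- The double sum is the total of `‖P_W (y a)‖²`; each member lying in `W` contributes its full
  -- squared norm `d`.
  have h1 : ∑ a, ∑ j, (inner ℝ (b j : EuclideanSpace ℝ ι) (y a)) ^ 2 =
      (Fintype.card A : ℝ) * Module.finrank ℝ W := by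
    rw [Finset.sum_comm]
    simp_rw [hiso]
    have : ∀ j, ‖(b j : EuclideanSpace ℝ ι)‖ = 1 := fun j => b.orthonormal.1 j
    simp [this, mul_comm]
  rw [← h1, ← nsmul_eq_mul]
  refine (Finset.card_nsmul_le_sum _ (fun a => ∑ j, (inner ℝ (b j : EuclideanSpace ℝ ι) (y a)) ^ 2)
    _ fun a ha => ?_).trans
    (Finset.sum_le_sum_of_subset_of_nonneg (Finset.filter_subset _ _) fun a _ _ =>
      Finset.sum_nonneg fun j _ => sq_nonneg _)
  have ha' : y a ∈ W := (Finset.mem_filter.1 ha).2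
  have h2 := b.sum_sq_inner_right ⟨y a, ha'⟩
  simp only [Submodule.coe_inner, Submodule.coe_norm] at h2
  rw [h2, hnorm]

/-- Among the `n`-tuples of members of an isotropic family of vectors of squared norm `d` in `ℝ^d`,
the average codimension of the span is at most `d (1 - 1/d)^n`. -/
theorem sum_codim_span_le {A ι : Type*} [Fintype A] [Fintype ι] [Nonempty ι]
    (y : A → EuclideanSpace ℝ ι)
    (hiso : ∀ v, ∑ a, (inner ℝ v (y a)) ^ 2 = Fintype.card A * ‖v‖ ^ 2)
    (hnorm : ∀ a, ‖y a‖ ^ 2 = Fintype.card ι) (n : ℕ) :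
    ∑ f : Fin n → A, ((Fintype.card ι : ℝ) -
        Module.finrank ℝ (Submodule.span ℝ (Set.range (y ∘ f)))) ≤
      Fintype.card ι * (Fintype.card A : ℝ) ^ n * (1 - 1 / (Fintype.card ι : ℝ)) ^ n := by
  classical
  have hd : (0 : ℝ) < Fintype.card ι := by exact_mod_cast Fintype.card_pos
  induction n with
  | zero => simp
  | succ n ih =>
    rw [← (Fin.consEquiv fun _ => A).sum_comp, Fintype.sum_prod_type_right]
    have key : ∀ g : Fin n → A, ∑ a : A, ((Fintype.card ι : ℝ) - Module.finrank ℝ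
          (Submodule.span ℝ (Set.range (y ∘ (Fin.consEquiv fun _ => A) (a, g))))) ≤
        Fintype.card A * (1 - 1 / (Fintype.card ι : ℝ)) * ((Fintype.card ι : ℝ) -
          Module.finrank ℝ (Submodule.span ℝ (Set.range (y ∘ g)))) := by
      intro g
      set W := Submodule.span ℝ (Set.range (y ∘ g)) with hW
      -- A new vector lowers the codimension `q` of `W` unless it lies in `W`, which has proportion
      -- at most `1 - q/d`; the average is thus at most `q - 1 + (1 - q/d) = q (1 - 1/d)`.
      have hstep : ∀ a : A, ((Fintype.card ι : ℝ) - Module.finrank ℝ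
          (Submodule.span ℝ (Set.range (y ∘ (Fin.consEquiv fun _ => A) (a, g))))) ≤
          ((Fintype.card ι : ℝ) - Module.finrank ℝ W - 1) + if y a ∈ W then 1 else 0 := by
        intro a
        have hr : Set.range (y ∘ (Fin.consEquiv fun _ => A) (a, g)) =
            insert (y a) (Set.range (y ∘ g)) := by
          have : y ∘ (Fin.consEquiv fun _ => A) (a, g) = Fin.cons (y a) (y ∘ g) :=
            Fin.comp_cons y a g
          rw [this, Fin.range_cons]
        rw [hr]
        split_ifs with h
        · have hle : W ≤ Submodule.span ℝ (insert (y a) (Set.range (y ∘ g))) :=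
            Submodule.span_mono (Set.subset_insert _ _)
          have : (Module.finrank ℝ W : ℝ) ≤ Module.finrank ℝ
              (Submodule.span ℝ (insert (y a) (Set.range (y ∘ g)))) := by
            exact_mod_cast Submodule.finrank_mono hle
          linarith
        · have hlt : W < Submodule.span ℝ (insert (y a) (Set.range (y ∘ g))) :=
            lt_of_le_of_ne (Submodule.span_mono (Set.subset_insert _ _)) fun he =>
              h (he ▸ Submodule.subset_span (Set.mem_insert _ _))
          have : (Module.finrank ℝ W : ℝ) + 1 ≤ Module.finrank ℝ
              (Submodule.span ℝ (insert (y a) (Set.range (y ∘ g)))) := by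
            exact_mod_cast Submodule.finrank_lt_finrank_of_lt hlt
          linarith
      refine (Finset.sum_le_sum fun a _ => hstep a).trans ?_
      rw [Finset.sum_add_distrib, Finset.sum_boole]
      have hc := card_mem_submodule_mul_le y hiso hnorm W
      rw [← le_div_iff₀ hd] at hc
      simp only [Finset.sum_const, Finset.card_univ, nsmul_eq_mul]
      refine (add_le_add_right hc _).trans (le_of_eq ?_)
      field_simp
      ring
    refine (Finset.sum_le_sum fun g _ => key g).trans ?_
    rw [← Finset.mul_sum]
    have h1 : 0 ≤ 1 - 1 / (Fintype.card ι : ℝ) := by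
      rw [sub_nonneg, div_le_one hd]
      exact_mod_cast Fintype.card_pos
    refine (mul_le_mul_of_nonneg_left ih (by positivity)).trans (le_of_eq ?_)
    ring

/-- Among the `n`-tuples of members of an isotropic family of vectors of squared norm `d` in `ℝ^d`,
at most a proportion `N exp (-n / N)` fails to span, for every `N ≥ d`. -/
theorem card_span_ne_top_le {A ι : Type*} [Fintype A] [Fintype ι] [Nonempty ι]
    (y : A → EuclideanSpace ℝ ι)
    (hiso : ∀ v, ∑ a, (inner ℝ v (y a)) ^ 2 = Fintype.card A * ‖v‖ ^ 2)
    (hnorm : ∀ a, ‖y a‖ ^ 2 = Fintype.card ι) (n : ℕ) {N : ℝ} (hN : Fintype.card ι ≤ N)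
    [DecidablePred fun f : Fin n → A => Submodule.span ℝ (Set.range (y ∘ f)) = ⊤] :
    ((Finset.univ.filter fun f : Fin n → A =>
        ¬ Submodule.span ℝ (Set.range (y ∘ f)) = ⊤).card : ℝ) ≤
      N * Real.exp (-n / N) * (Fintype.card A : ℝ) ^ n := by
  have hd : (1 : ℝ) ≤ Fintype.card ι := by exact_mod_cast Fintype.card_pos
  have hle : ∀ f : Fin n → A, (Module.finrank ℝ (Submodule.span ℝ (Set.range (y ∘ f))) : ℝ) ≤
      Fintype.card ι := fun f => by
    have := Submodule.finrank_le (Submodule.span ℝ (Set.range (y ∘ f)))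
    rw [finrank_euclideanSpace] at this
    exact_mod_cast this
  have h1 : ((Finset.univ.filter fun f : Fin n → A =>
        ¬ Submodule.span ℝ (Set.range (y ∘ f)) = ⊤).card : ℝ) ≤
      ∑ f : Fin n → A, ((Fintype.card ι : ℝ) -
        Module.finrank ℝ (Submodule.span ℝ (Set.range (y ∘ f)))) := by
    -- Markov's inequality: a tuple that fails to span has codimension at least `1`.
    rw [← nsmul_one]
    refine (Finset.card_nsmul_le_sum _ (fun f => ((Fintype.card ι : ℝ) -
        Module.finrank ℝ (Submodule.span ℝ (Set.range (y ∘ f))))) _ fun f hf => ?_).trans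
      (Finset.sum_le_sum_of_subset_of_nonneg (Finset.filter_subset _ _) fun f _ _ =>
        sub_nonneg.2 (hle f))
    have hlt := Submodule.finrank_lt (lt_top_iff_ne_top.2 (Finset.mem_filter.1 hf).2).ne
    rw [finrank_euclideanSpace] at hlt
    have : (Module.finrank ℝ (Submodule.span ℝ (Set.range (y ∘ f))) : ℝ) + 1 ≤
      Fintype.card ι := by exact_mod_cast hlt
    linarith
  refine h1.trans ((sum_codim_span_le y hiso hnorm n).trans ?_)
  have h2 : (1 - 1 / (Fintype.card ι : ℝ)) ≤ Real.exp (-1 / N) := by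
    have h3 : 1 / N ≤ 1 / (Fintype.card ι : ℝ) := one_div_le_one_div_of_le (by linarith) hN
    have h4 := Real.add_one_le_exp (-1 / N)
    rw [neg_div] at h4 ⊢
    linarith
  have h0 : 0 ≤ 1 - 1 / (Fintype.card ι : ℝ) := by
    rw [sub_nonneg, div_le_one (by linarith)]
    exact hd
  have h3 : Real.exp (-n / N) = Real.exp (-1 / N) ^ n := by
    rw [← Real.exp_nat_mul]
    ring_nf
  rw [h3, mul_right_comm]
  have hN0 : 0 ≤ N := by linarith
  gcongr

/-! ### Monomials on the sign cube and general position. -/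

/-- The index set of the constant monomial and of the monomials `x_k x_l` with `k < l`. -/
abbrev PairIndex (r : ℕ) : Type := Option {p : Fin r × Fin r // p.1 < p.2}

theorem card_pairIndex_le {r : ℕ} (hr : 1 ≤ r) : Fintype.card (PairIndex r) ≤ r ^ 2 := by
  -- The constant monomial is sent to the diagonal pair `(0, 0)`, which no pair `k < l` uses.
  have hinj : Function.Injective fun o : PairIndex r =>
      o.elim ((⟨0, hr⟩, ⟨0, hr⟩) : Fin r × Fin r) Subtype.val := by
    rintro (_ | ⟨p, hp⟩) (_ | ⟨q, hq⟩) h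
    · rfl
    · simp only [Option.elim] at h
      rw [← h] at hq
      exact absurd hq (lt_irrefl _)
    · simp only [Option.elim] at h
      rw [h] at hp
      exact absurd hp (lt_irrefl _)
    · simpa using h
  simpa [sq] using Fintype.card_le_of_injective _ hinj

/-- The values at a sign vector `s` of the monomials `1` and `x_k x_l`, `k < l`. -/
def pairVec {r : ℕ} (s : Fin r → ℤˣ) : EuclideanSpace ℝ (PairIndex r) :=
  WithLp.toLp 2 fun o => o.elim 1 fun p => ((s p.1.1 : ℤ) : ℝ) * ((s p.1.2 : ℤ) : ℝ)

theorem unit_mul_self_real (u : ℤˣ) : ((u : ℤ) : ℝ) * ((u : ℤ) : ℝ) = 1 := by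
  exact_mod_cast Int.units_coe_mul_self u

theorem norm_sq_pairVec {r : ℕ} (s : Fin r → ℤˣ) :
    ‖pairVec s‖ ^ 2 = Fintype.card (PairIndex r) := by
  have h : ∀ o, pairVec s o * pairVec s o = 1 := by
    rintro (_ | p)
    · simp [pairVec]
    · simp only [pairVec, Option.elim]
      rw [mul_mul_mul_comm, unit_mul_self_real, unit_mul_self_real, one_mul]
  rw [EuclideanSpace.real_norm_sq_eq]
  simp_rw [sq, h]
  simp

/-- The set of variables of a monomial. -/
def PairIndex.support {r : ℕ} (o : PairIndex r) : Finset (Fin r) :=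
  o.elim ∅ fun p => {p.1.1, p.1.2}

theorem PairIndex.support_injective {r : ℕ} :
    Function.Injective (PairIndex.support : PairIndex r → Finset (Fin r)) := by
  rintro (_ | ⟨⟨a, b⟩, hp⟩) (_ | ⟨⟨c, d⟩, hq⟩) h
  · rfl
  · simp [PairIndex.support] at h
    exact absurd (h.symm ▸ Finset.mem_insert_self c {d}) (Finset.notMem_empty c)
  · simp [PairIndex.support] at h
  · simp only [PairIndex.support, Option.elim, Finset.ext_iff, Finset.mem_insert,
      Finset.mem_singleton] at h
    simp only at hp hq
    have h1 := (h a).1 (Or.inl rfl)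
    have h2 := (h b).1 (Or.inr rfl)
    have h3 := (h c).2 (Or.inl rfl)
    have h4 := (h d).2 (Or.inr rfl)
    have : a = c ∧ b = d := by omega
    simp [this]

theorem pairVec_eq_prod {r : ℕ} (s : Fin r → ℤˣ) (o : PairIndex r) :
    pairVec s o = ∏ k, if k ∈ o.support then ((s k : ℤ) : ℝ) else 1 := by
  rw [Finset.prod_ite_mem, Finset.univ_inter]
  rcases o with _ | ⟨⟨a, b⟩, hp⟩
  · simp [pairVec, PairIndex.support]
  · simp only [pairVec, PairIndex.support, Option.elim]
    rw [Finset.prod_pair (ne_of_lt hp)]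

/-- Orthogonality of characters of `{±1}^r`: a variable in exactly one of two distinct supports
contributes the factor `1 + (-1) = 0`. -/
theorem sum_pairVec_mul {r : ℕ} (o o' : PairIndex r) :
    ∑ s : Fin r → ℤˣ, pairVec s o * pairVec s o' =
      if o = o' then (Fintype.card (Fin r → ℤˣ) : ℝ) else 0 := by
  split_ifs with h
  · subst h
    have : ∀ s, pairVec s o * pairVec s o = 1 := by
      intro s
      rw [pairVec_eq_prod, ← Finset.prod_mul_distrib]
      refine Finset.prod_eq_one fun k _ => ?_
      split_ifs
      · exact unit_mul_self_real _
      · simp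
    simp [this]
  · have hne : o.support ≠ o'.support := fun he => h (PairIndex.support_injective he)
    obtain ⟨k, hk⟩ : ∃ k, ¬ (k ∈ o.support ↔ k ∈ o'.support) := by
      by_contra! hc
      exact hne (Finset.ext hc)
    simp_rw [pairVec_eq_prod, ← Finset.prod_mul_distrib]
    rw [← Fintype.prod_sum fun (k : Fin r) (u : ℤˣ) => (if k ∈ o.support then ((u : ℤ) : ℝ) else 1) *
      if k ∈ o'.support then ((u : ℤ) : ℝ) else 1]
    refine Finset.prod_eq_zero (Finset.mem_univ k) ?_
    rw [show (Finset.univ : Finset ℤˣ) = {1, -1} from rfl, Finset.sum_pair (by decide)]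
    by_cases h1 : k ∈ o.support <;> by_cases h2 : k ∈ o'.support <;> simp [h1, h2] at hk ⊢

theorem sum_inner_pairVec_sq {r : ℕ} (v : EuclideanSpace ℝ (PairIndex r)) :
    ∑ s : Fin r → ℤˣ, (inner ℝ v (pairVec s)) ^ 2 =
      Fintype.card (Fin r → ℤˣ) * ‖v‖ ^ 2 := by
  have h : ∀ s : Fin r → ℤˣ, (inner ℝ v (pairVec s)) ^ 2 =
      ∑ o, ∑ o', v o * v o' * (pairVec s o * pairVec s o') := by
    intro s
    rw [sq, PiLp.inner_apply, Finset.sum_mul_sum]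
    refine Finset.sum_congr rfl fun o _ => Finset.sum_congr rfl fun o' _ => ?_
    simp only [RCLike.inner_apply, conj_trivial]
    ring
  simp_rw [h]
  rw [Finset.sum_comm]
  simp_rw [Finset.sum_comm (s := (Finset.univ : Finset (Fin r → ℤˣ))), ← Finset.mul_sum,
    sum_pairVec_mul]
  rw [EuclideanSpace.real_norm_sq_eq, Finset.mul_sum]
  refine Finset.sum_congr rfl fun o _ => ?_
  simp
  ring

/-- The sign vectors `c₁, …, c_r` are in general position: no nonzero quadratic polynomial in the
span of `1` and `x_k x_l`, `k < l`, vanishes on all the points `(c₁ i, …, c_r i)`. -/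
def InGeneralPosition {r n : ℕ} (c : Fin r → Fin n → ℤˣ) : Prop :=
  Submodule.span ℝ (Set.range fun i => pairVec fun k => c k i) = ⊤

open Classical in
theorem card_inGeneralPosition_ge {r : ℕ} (hr : 1 ≤ r) (n : ℕ) :
    (1 - (r : ℝ) ^ 2 * Real.exp (-(n : ℝ) / (r : ℝ) ^ 2)) * ((2 : ℝ) ^ n) ^ r ≤
      (Finset.univ.filter fun c : Fin r → Fin n → ℤˣ => InGeneralPosition c).card := by
  have hb := card_span_ne_top_le (pairVec (r := r)) sum_inner_pairVec_sq norm_sq_pairVec n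
    (N := (r : ℝ) ^ 2) (by exact_mod_cast card_pairIndex_le hr)
  have he : (Finset.univ.filter fun f : Fin n → Fin r → ℤˣ =>
        ¬ Submodule.span ℝ (Set.range (pairVec ∘ f)) = ⊤).card =
      (Finset.univ.filter fun c : Fin r → Fin n → ℤˣ => ¬ InGeneralPosition c).card := by
    -- Transposition turns `r` sign vectors of length `n` into `n` points of `{±1}^r`.
    refine Finset.card_equiv (Equiv.piComm _) fun f => ?_
    simp only [Finset.mem_filter, Finset.mem_univ, true_and]
    rfl
  have hs := Finset.card_filter_add_card_filter_not (s := Finset.univ)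
    (fun c : Fin r → Fin n → ℤˣ => InGeneralPosition c)
  have hs' : ((Finset.univ.filter fun c : Fin r → Fin n → ℤˣ => InGeneralPosition c).card : ℝ) +
      (Finset.univ.filter fun c : Fin r → Fin n → ℤˣ => ¬ InGeneralPosition c).card =
      ((2 : ℝ) ^ n) ^ r := by
    rw [← Nat.cast_add, hs]
    simp
  rw [he] at hb
  have hc : ((Fintype.card (Fin r → ℤˣ) : ℕ) : ℝ) ^ n = ((2 : ℝ) ^ n) ^ r := by
    simp [← pow_mul, mul_comm]
  rw [hc] at hb
  linarith

/-! ### Quadratic forms on a family in general position. -/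

/-- The real vector with the given signs as entries. -/
def signVec {n : ℕ} (s : Fin n → ℤˣ) : Fin n → ℝ := fun i => ((s i : ℤ) : ℝ)

theorem signVec_mul_self {n : ℕ} (s : Fin n → ℤˣ) (i : Fin n) : signVec s i * signVec s i = 1 :=
  unit_mul_self_real _

theorem signVec_injective {n : ℕ} : Function.Injective (signVec (n := n)) := fun _ _ h =>
  funext fun i => Units.ext (Int.cast_injective (congrFun h i))

theorem isCutVector_signVec {n : ℕ} (s : Fin n → ℤˣ) : IsCutVector (signVec s) := by
  intro i
  rcases Int.units_eq_one_or (s i) with h | h <;> simp [signVec, h]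

theorem IsCutVector.exists_signVec {n : ℕ} {c : Fin n → ℝ} (hc : IsCutVector c) :
    ∃ s, signVec s = c := by
  refine ⟨fun i => if c i = 1 then 1 else -1, funext fun i => ?_⟩
  rcases hc i with h | h <;> norm_num [signVec, h]

theorem InGeneralPosition.eq_zero {r n : ℕ} {c : Fin r → Fin n → ℤˣ} (hc : InGeneralPosition c)
    (a : PairIndex r → ℝ) (ha : ∀ i, ∑ o, a o * pairVec (fun k => c k i) o = 0) : a = 0 := by
  have h : ∀ w : EuclideanSpace ℝ (PairIndex r), inner ℝ (WithLp.toLp 2 a) w = 0 := by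
    intro w
    have hw : w ∈ Submodule.span ℝ (Set.range fun i => pairVec fun k => c k i) := by
      rw [show Submodule.span ℝ (Set.range fun i => pairVec fun k => c k i) = ⊤ from hc]
      trivial
    induction hw using Submodule.span_induction with
    | mem x hx =>
      obtain ⟨i, rfl⟩ := hx
      rw [← ha i, PiLp.inner_apply]
      refine Finset.sum_congr rfl fun o _ => ?_
      simp [mul_comm]
    | zero => simp
    | add x y _ _ hx hy => rw [inner_add_right, hx, hy, add_zero]
    | smul t x _ hx => rw [inner_smul_right, hx, mul_zero]
  exact (WithLp.toLp_injective 2) (inner_self_eq_zero.1 (h _))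

theorem sum_sum_eq_diag_add_lt {r : ℕ} (g : Fin r → Fin r → ℝ) :
    ∑ k, ∑ l, g k l = ∑ k, g k k +
      ∑ p : {p : Fin r × Fin r // p.1 < p.2}, (g p.1.1 p.1.2 + g p.1.2 p.1.1) := by
  have h1 : ∀ k l, g k l = (if k = l then g k l else 0) +
      ((if k < l then g k l else 0) + (if l < k then g k l else 0)) := by
    intro k l
    rcases lt_trichotomy k l with h | h | h
    · simp [h, h.ne, h.not_gt]
    · simp [h]
    · simp [h, h.ne', h.not_gt]
  have h2 : ∑ k, ∑ l, (if l < k then g k l else 0) = ∑ k, ∑ l, (if k < l then g l k else 0) :=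
    Finset.sum_comm
  rw [Finset.sum_congr rfl fun k _ => Finset.sum_congr rfl fun l _ => h1 k l]
  simp_rw [Finset.sum_add_distrib]
  rw [h2]
  congr 1
  · simp
  rw [← Fintype.sum_prod_type' (f := fun k l => if k < l then g k l else 0),
    ← Fintype.sum_prod_type' (f := fun k l => if k < l then g l k else 0)]
  rw [← Finset.sum_filter, ← Finset.sum_filter]
  have hmem : ∀ p : Fin r × Fin r,
      p ∈ Finset.univ.filter (fun p : Fin r × Fin r => p.1 < p.2) ↔ p.1 < p.2 := by simp
  rw [Finset.sum_subtype _ hmem (fun p => g p.1 p.2), Finset.sum_subtype _ hmem (fun p => g p.2 p.1)]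

/-- If a symmetric quadratic form is constant on the points `(c₁ i, …, c_r i)` of a family in
general position, then it is diagonal, and the constant is its trace. -/
theorem InGeneralPosition.diagonal {r n : ℕ} {c : Fin r → Fin n → ℤˣ} (hc : InGeneralPosition c)
    (M : Matrix (Fin r) (Fin r) ℝ) (hM : M.IsSymm) (t : ℝ)
    (h : ∀ i, ∑ k, ∑ l, M k l * (signVec (c k) i * signVec (c l) i) = t) :
    (∀ k l, k ≠ l → M k l = 0) ∧ ∑ k, M k k = t := by
  -- Since `x_k² = 1`, the diagonal of `M` joins the constant coefficient; symmetry doubles the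
  -- others.
  have h0 := hc.eq_zero (fun o => o.elim (∑ k, M k k - t) fun p => 2 * M p.1.1 p.1.2) (by
    intro i
    have hi := h i
    rw [sum_sum_eq_diag_add_lt] at hi
    simp_rw [signVec_mul_self, mul_one] at hi
    rw [Fintype.sum_option]
    simp only [Option.elim, pairVec, mul_one]
    rw [← hi, sub_add_eq_add_sub, sub_eq_zero]
    congr 1
    refine Finset.sum_congr rfl fun p _ => ?_
    rw [← hM.apply p.1.1 p.1.2]
    simp only [signVec]
    ring)
  have hlt : ∀ k l, k < l → M k l = 0 := fun k l hkl => by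
    simpa using congrFun h0 (some ⟨(k, l), hkl⟩)
  refine ⟨fun k l hkl => ?_, sub_eq_zero.1 (congrFun h0 none)⟩
  rcases lt_or_gt_of_ne hkl with h' | h'
  · exact hlt k l h'
  · rw [← hM.apply]
    exact hlt l k h'

/-- A relation `∑ a_l x_l = 0` at the points, multiplied by `x_m` and symmetrised, gives a vanishing
form whose trace is `2 a_m`. -/
theorem InGeneralPosition.linearIndependent {r n : ℕ} {c : Fin r → Fin n → ℤˣ}
    (hc : InGeneralPosition c) : LinearIndependent ℝ fun k => signVec (c k) := by
  rw [Fintype.linearIndependent_iff]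
  intro a ha m
  have ha' : ∀ i, ∑ l, a l * signVec (c l) i = 0 := fun i => by
    simpa using congrFun ha i
  obtain ⟨h1, h2⟩ := hc.diagonal
    (Matrix.of fun k l => (if k = m then a l else 0) + (if l = m then a k else 0))
    (by ext k l; simp [add_comm]) 0 (by
      intro i
      simp only [Matrix.of_apply, add_mul, Finset.sum_add_distrib, ite_mul, zero_mul]
      have e1 : ∑ k, ∑ l, (if k = m then a l * (signVec (c k) i * signVec (c l) i) else 0) = 0 := by
        rw [Finset.sum_comm]
        simp only [Finset.sum_ite_eq', Finset.mem_univ, if_true]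
        rw [← mul_zero (signVec (c m) i), ← ha' i, Finset.mul_sum]
        exact Finset.sum_congr rfl fun l _ => by ring
      have e2 : ∑ k, ∑ l, (if l = m then a k * (signVec (c k) i * signVec (c l) i) else 0) = 0 := by
        simp only [Finset.sum_ite_eq', Finset.mem_univ, if_true]
        rw [← mul_zero (signVec (c m) i), ← ha' i, Finset.mul_sum]
        exact Finset.sum_congr rfl fun l _ => by ring
      rw [e1, e2, add_zero])
  have : a m + a m = 0 := by
    simpa [Finset.sum_add_distrib] using h2
  linarith

/-! ### The hull as a simplicial face. -/

/-- The matrix with the given vectors as columns. -/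
def colMatrix {r n : ℕ} (v : Fin r → Fin n → ℝ) : Matrix (Fin n) (Fin r) ℝ :=
  Matrix.of fun i k => v k i

theorem exists_left_inverse_colMatrix {r n : ℕ} {v : Fin r → Fin n → ℝ}
    (hv : LinearIndependent ℝ v) : ∃ U : Matrix (Fin r) (Fin n) ℝ, U * colMatrix v = 1 := by
  have hinj : LinearMap.ker (Matrix.toLin' (colMatrix v)) = ⊥ := by
    rw [LinearMap.ker_eq_bot']
    intro a ha
    refine funext (Fintype.linearIndependent_iff.1 hv a ?_)
    rw [← ha]
    ext i
    simp [colMatrix, Matrix.mulVec, dotProduct, mul_comm]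
  obtain ⟨g, hg⟩ := LinearMap.exists_leftInverse_of_injective _ hinj
  refine ⟨LinearMap.toMatrix' g, ?_⟩
  rw [← LinearMap.toMatrix'_toLin' (colMatrix v), ← LinearMap.toMatrix'_comp, hg,
    LinearMap.toMatrix'_id]

theorem convex_elliptope (n : ℕ) : Convex ℝ (elliptope n) := by
  rintro X ⟨hX, hX1⟩ Y ⟨hY, hY1⟩ a b ha hb hab
  exact ⟨(hX.smul ha).add (hY.smul hb), fun i => by simp [hX1, hY1, hab]⟩

theorem cutMatrix_mem_elliptope {n : ℕ} {c : Fin n → ℝ} (hc : IsCutVector c) :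
    cutMatrix c ∈ elliptope n := by
  refine ⟨by simpa [cutMatrix] using Matrix.posSemidef_vecMulVec_self_star c, fun i => ?_⟩
  rcases hc i with h | h <;> simp [cutMatrix, Matrix.vecMulVec_apply, h]

theorem cutPolytope_subset_elliptope (n : ℕ) : cutPolytope n ⊆ elliptope n :=
  convexHull_min (by rintro _ ⟨c, hc, rfl⟩; exact cutMatrix_mem_elliptope hc) (convex_elliptope n)

theorem cutHull_subset_cutPolytope {r n : ℕ} {c : Fin r → Fin n → ℝ} (hc : ∀ k, IsCutVector (c k)) :
    cutHull c ⊆ cutPolytope n :=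
  convexHull_mono (by rintro _ ⟨k, rfl⟩; exact ⟨c k, hc k, rfl⟩)

theorem dotProduct_mulVec_eq_zero_of_mem_cutHull {r n : ℕ} {c : Fin r → Fin n → ℝ}
    {Z : Matrix (Fin n) (Fin n) ℝ} (hZ : Z ∈ cutHull c) {x : Fin n → ℝ}
    (hx : ∀ k, c k ⬝ᵥ x = 0) : x ⬝ᵥ Z.mulVec x = 0 := by
  have : cutHull c ⊆ {Z | x ⬝ᵥ Z.mulVec x = 0} := by
    refine convexHull_min ?_ ?_
    · rintro _ ⟨k, rfl⟩
      simp [cutMatrix, Matrix.vecMulVec_mulVec, hx]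
    · intro X hX Y hY a b _ _ _
      simp only [Set.mem_ofPred_eq] at hX hY ⊢
      simp [Matrix.add_mulVec, Matrix.smul_mulVec, hX, hY]
  exact this hZ

theorem mul_eq_self_of_mulVec_eq_zero {r n : ℕ} {v : Fin r → Fin n → ℝ}
    {U : Matrix (Fin r) (Fin n) ℝ} (hU : U * colMatrix v = 1) {X : Matrix (Fin n) (Fin n) ℝ}
    (hX : X.IsSymm) (h : ∀ x : Fin n → ℝ, (∀ k, v k ⬝ᵥ x = 0) → X.mulVec x = 0) :
    X = colMatrix v * (U * X * U.transpose) * (colMatrix v).transpose := by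
  set V := colMatrix v with hV
  -- The columns of `1 - Uᵀ Vᵀ` are orthogonal to every `v k`, so `X` kills them and `X = X Uᵀ Vᵀ`;
  -- transposing gives `X = V U X`.
  have hQ : V.transpose * (1 - U.transpose * V.transpose) = 0 := by
    rw [Matrix.mul_sub, Matrix.mul_one, ← Matrix.mul_assoc, ← Matrix.transpose_mul U V, hU]
    simp
  have h1 : X * (1 - U.transpose * V.transpose) = 0 := by
    refine Matrix.ext_col fun j => ?_
    have h2 := h ((1 - U.transpose * V.transpose).col j) (fun k => by
      have := congrFun (congrFun hQ k) j
      simpa [Matrix.mul_apply, dotProduct, hV, colMatrix, Matrix.col] using this)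
    ext i
    have := congrFun h2 i
    simpa [Matrix.mul_apply, Matrix.mulVec, dotProduct, Matrix.col] using this
  rw [Matrix.mul_sub, Matrix.mul_one, sub_eq_zero] at h1
  have h3 : X = V * U * X := by
    have := congrArg Matrix.transpose h1
    simpa [Matrix.transpose_mul, hX.eq, Matrix.mul_assoc] using this
  calc X = V * U * X := h3
    _ = V * U * (X * (U.transpose * V.transpose)) := by rw [← h1]
    _ = _ := by simp only [Matrix.mul_assoc]

theorem InGeneralPosition.left_mem_cutHull {r n : ℕ} {c : Fin r → Fin n → ℤˣ}
    (hc : InGeneralPosition c) {X Y : Matrix (Fin n) (Fin n) ℝ} (hX : X ∈ elliptope n)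
    (hY : Y ∈ elliptope n) {θ : ℝ} (h0 : 0 < θ) (h1 : θ < 1)
    (h : θ • X + (1 - θ) • Y ∈ cutHull fun k => signVec (c k)) :
    X ∈ cutHull fun k => signVec (c k) := by
  obtain ⟨U, hU⟩ := exists_left_inverse_colMatrix hc.linearIndependent
  have hker : ∀ x : Fin n → ℝ, (∀ k, signVec (c k) ⬝ᵥ x = 0) → X.mulVec x = 0 := by
    intro x hx
    have hz := dotProduct_mulVec_eq_zero_of_mem_cutHull h hx
    simp only [Matrix.add_mulVec, Matrix.smul_mulVec, dotProduct_add, dotProduct_smul,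
      smul_eq_mul] at hz
    have hx0 := hX.1.dotProduct_mulVec_nonneg x
    have hy0 := hY.1.dotProduct_mulVec_nonneg x
    simp only [star_trivial] at hx0 hy0
    -- Two nonnegative terms with sum zero both vanish.
    have : x ⬝ᵥ X.mulVec x = 0 := by
      have := mul_nonneg (sub_nonneg.2 h1.le) hy0
      have := mul_nonneg h0.le hx0
      have : θ * x ⬝ᵥ X.mulVec x = 0 := by linarith
      exact (mul_eq_zero.1 this).resolve_left h0.ne'
    exact (hX.1.dotProduct_mulVec_zero_iff x).1 (by simpa using this)
  have hsymm : X.IsSymm := by simpa [Matrix.IsSymm] using hX.1.isHermitian.eq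
  have hXM := mul_eq_self_of_mulVec_eq_zero hU hsymm hker
  set M := U * X * U.transpose with hMdef
  have hMpsd : M.PosSemidef := by
    simpa using hX.1.mul_mul_conjTranspose_same U
  have hMsymm : M.IsSymm := by simpa [Matrix.IsSymm] using hMpsd.isHermitian.eq
  have hentry : ∀ i j, X i j = ∑ k, ∑ l, M k l * (signVec (c k) i * signVec (c l) j) := by
    intro i j
    conv_lhs => rw [hXM]
    simp only [Matrix.mul_apply, colMatrix, Matrix.of_apply, Matrix.transpose_apply,
      Finset.sum_mul]
    rw [Finset.sum_comm]
    exact Finset.sum_congr rfl fun k _ => Finset.sum_congr rfl fun l _ => by ring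
  -- The unit diagonal of `X` is the hypothesis that the form of `M` is constantly `1` on the
  -- points.
  obtain ⟨hoff, htr⟩ := hc.diagonal M hMsymm 1 fun i => (hentry i i).symm.trans (hX.2 i)
  have hsum : X = ∑ k, M k k • cutMatrix (signVec (c k)) := by
    ext i j
    rw [hentry, Matrix.sum_apply]
    refine Finset.sum_congr rfl fun k _ => ?_
    rw [Finset.sum_eq_single k (fun l _ hl => by rw [hoff k l hl.symm, zero_mul]) (by simp)]
    simp [cutMatrix, Matrix.vecMulVec_apply]
  rw [hsum]
  exact (convex_convexHull ℝ _).sum_mem (fun k _ => hMpsd.diag_nonneg) htr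
    fun k _ => subset_convexHull ℝ _ ⟨k, rfl⟩

theorem InGeneralPosition.isFace_elliptope {r n : ℕ} {c : Fin r → Fin n → ℤˣ}
    (hc : InGeneralPosition c) : IsFace (elliptope n) (cutHull fun k => signVec (c k)) where
  convex := convex_convexHull ℝ _
  subset := (cutHull_subset_cutPolytope fun k => isCutVector_signVec (c k)).trans
    (cutPolytope_subset_elliptope n)
  extreme X hX Y hY θ h0 h1 h := by
    refine ⟨hc.left_mem_cutHull hX hY h0 h1 h,
      hc.left_mem_cutHull hY hX (sub_pos.2 h1) (sub_lt_self 1 h0) ?_⟩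
    rwa [sub_sub_cancel, add_comm]

/-- Row `i` of a relation among the `v_k v_kᵀ` is a relation among the `v_k` with coefficients `a_k
v_k i`. -/
theorem linearIndependent_cutMatrix {r n : ℕ} {v : Fin r → Fin n → ℝ}
    (hv : LinearIndependent ℝ v) : LinearIndependent ℝ fun k => cutMatrix (v k) := by
  rw [Fintype.linearIndependent_iff]
  intro a ha k
  have h1 : ∀ i, ∑ k, (a k * v k i) • v k = 0 := by
    intro i
    ext j
    have := congrFun (congrFun ha i) j
    simpa [Matrix.sum_apply, cutMatrix, Matrix.vecMulVec_apply, mul_assoc] using this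
  have h2 : ∀ i, a k * v k i = 0 := fun i => Fintype.linearIndependent_iff.1 hv _ (h1 i) k
  by_contra hk
  exact hv.ne_zero k (funext fun i => (mul_eq_zero.1 (h2 i)).resolve_left hk)

theorem IsFace.mono {E : Type*} [AddCommGroup E] [Module ℝ E] {K L F : Set E} (h : IsFace K F)
    (hL : L ⊆ K) (hF : F ⊆ L) : IsFace L F :=
  ⟨h.convex, hF, fun x hx y hy => h.extreme x (hL hx) y (hL hy)⟩

theorem IsSimplicialFace.mono {E : Type*} [AddCommGroup E] [Module ℝ E] {K L F : Set E} {k : ℕ}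
    (h : IsSimplicialFace K F k) (hL : L ⊆ K) (hF : F ⊆ L) : IsSimplicialFace L F k :=
  ⟨h.isFace.mono hL hF, h.dim_eq, h.simplex⟩

theorem InGeneralPosition.isSimplicialFace {r n : ℕ} (hr : 1 ≤ r) {c : Fin r → Fin n → ℤˣ}
    (hc : InGeneralPosition c) :
    IsSimplicialFace (elliptope n) (cutHull fun k => signVec (c k)) (r - 1) := by
  obtain ⟨m, rfl⟩ : ∃ m, r = m + 1 := ⟨r - 1, by omega⟩
  have hai := (linearIndependent_cutMatrix hc.linearIndependent).affineIndependent
  refine ⟨hc.isFace_elliptope, ?_, _, hai, rfl⟩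
  rw [affineDim, cutHull, affineSpan_convexHull, direction_affineSpan]
  exact hai.finrank_vectorSpan (by simp)

theorem InGeneralPosition.mem_sharedSimplicialFaces {r n : ℕ} (hr : 1 ≤ r)
    {c : Fin r → Fin n → ℤˣ} (hc : InGeneralPosition c) :
    (cutHull fun k => signVec (c k)) ∈ sharedSimplicialFaces n (r - 1) :=
  ⟨hc.isSimplicialFace hr, (hc.isSimplicialFace hr).mono (cutPolytope_subset_elliptope n)
    (cutHull_subset_cutPolytope fun k => isCutVector_signVec (c k))⟩

/-! ### Finiteness of the set of common faces. -/

theorem IsFace.subset_convexHull_inter {E : Type*} [AddCommGroup E] [Module ℝ E] {T F : Set E}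
    (h : IsFace (convexHull ℝ T) F) : F ⊆ convexHull ℝ (F ∩ T) := by
  -- The implication is built into the set so that the face property makes the set convex; it
  -- contains `T` trivially.
  have hT : convexHull ℝ T ⊆ {x | x ∈ convexHull ℝ T ∧ (x ∈ F → x ∈ convexHull ℝ (F ∩ T))} := by
    refine convexHull_min (fun x hx => ⟨subset_convexHull ℝ _ hx, fun hF =>
      subset_convexHull ℝ _ ⟨hF, hx⟩⟩) ?_
    rw [convex_iff_forall_pos]
    rintro x ⟨hx, hx'⟩ y ⟨hy, hy'⟩ a b ha hb hab
    refine ⟨convex_convexHull ℝ T hx hy ha.le hb.le hab, fun hF => ?_⟩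
    obtain rfl : b = 1 - a := by linarith
    obtain ⟨hxF, hyF⟩ := h.extreme x hx y hy a ha (by linarith) hF
    exact convex_convexHull ℝ _ (hx' hxF) (hy' hyF) ha.le hb.le hab
  exact fun x hx => (hT (h.subset hx)).2 hx

theorem IsFace.eq_convexHull_inter {E : Type*} [AddCommGroup E] [Module ℝ E] {T F : Set E}
    (h : IsFace (convexHull ℝ T) F) : F = convexHull ℝ (F ∩ T) :=
  h.subset_convexHull_inter.antisymm (convexHull_min Set.inter_subset_left h.convex)

theorem finite_setOf_isFace {E : Type*} [AddCommGroup E] [Module ℝ E] {T : Set E}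
    (hT : T.Finite) : {F | IsFace (convexHull ℝ T) F}.Finite :=
  (hT.finite_subsets.image (convexHull ℝ)).subset fun F hF =>
    ⟨F ∩ T, Set.inter_subset_right, (IsFace.eq_convexHull_inter hF).symm⟩

theorem finite_sharedSimplicialFaces (n k : ℕ) : (sharedSimplicialFaces n k).Finite := by
  refine (finite_setOf_isFace ?_).subset fun F hF => hF.2.isFace
  refine (Set.finite_range fun s : Fin n → ℤˣ => cutMatrix (signVec s)).subset ?_
  rintro _ ⟨c, hc, rfl⟩
  obtain ⟨s, rfl⟩ := hc.exists_signVec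
  exact ⟨s, rfl⟩

/-! ### Families with the same hull. -/

theorem signVec_mul_le_one {n : ℕ} (s t : Fin n → ℤˣ) (i j : Fin n) :
    signVec s i * signVec s j * (signVec t i * signVec t j) ≤ 1 := by
  rcases isCutVector_signVec s i with h1 | h1 <;> rcases isCutVector_signVec s j with h2 | h2 <;>
  rcases isCutVector_signVec t i with h3 | h3 <;> rcases isCutVector_signVec t j with h4 | h4 <;>
  norm_num [h1, h2, h3, h4]

/-- The functional `X ↦ sᵀ X s` attains its maximum `n²` over cut matrices only at `s sᵀ`, so `s sᵀ`
lies in no hull of other cut matrices. -/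
theorem exists_cutMatrix_eq_of_mem_cutHull {r n : ℕ} {s : Fin n → ℤˣ} {c : Fin r → Fin n → ℤˣ}
    (h : cutMatrix (signVec s) ∈ cutHull fun k => signVec (c k)) :
    ∃ k, cutMatrix (signVec (c k)) = cutMatrix (signVec s) := by
  by_contra! hne
  let φ : Matrix (Fin n) (Fin n) ℝ → ℝ := fun X => ∑ i, ∑ j, signVec s i * signVec s j * X i j
  have hφ : IsLinearMap ℝ φ :=
    ⟨fun X Y => by simp [φ, mul_add, Finset.sum_add_distrib],
      fun a X => by simp [φ, Finset.mul_sum, mul_left_comm]⟩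
  have hs : φ (cutMatrix (signVec s)) = ∑ _i : Fin n, ∑ _j : Fin n, (1 : ℝ) := by
    refine Finset.sum_congr rfl fun i _ => Finset.sum_congr rfl fun j _ => ?_
    rw [cutMatrix, Matrix.vecMulVec_apply, mul_mul_mul_comm, signVec_mul_self, signVec_mul_self,
      one_mul]
  have hsub : (cutHull fun k => signVec (c k)) ⊆ {X | φ X < φ (cutMatrix (signVec s))} := by
    refine convexHull_min ?_ (convex_halfSpace_lt hφ _)
    rintro _ ⟨k, rfl⟩
    obtain ⟨i, j, hij⟩ : ∃ i j, cutMatrix (signVec (c k)) i j ≠ cutMatrix (signVec s) i j := by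
      by_contra! he
      exact hne k (Matrix.ext he)
    have hle : ∀ i j, signVec s i * signVec s j * cutMatrix (signVec (c k)) i j ≤ 1 :=
      fun i j => signVec_mul_le_one s (c k) i j
    rw [Set.mem_ofPred_eq, hs]
    refine Finset.sum_lt_sum (fun i _ => Finset.sum_le_sum fun j _ => hle i j)
      ⟨i, Finset.mem_univ i, Finset.sum_lt_sum (fun j _ => hle i j)
        ⟨j, Finset.mem_univ j, lt_of_le_of_ne (hle i j) fun he => hij ?_⟩⟩
    have h1 := signVec_mul_self s i
    have h2 := signVec_mul_self s j
    calc cutMatrix (signVec (c k)) i j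
        = (signVec s i * signVec s i) * (signVec s j * signVec s j) *
          cutMatrix (signVec (c k)) i j := by rw [h1, h2]; ring
      _ = signVec s i * signVec s j *
          (signVec s i * signVec s j * cutMatrix (signVec (c k)) i j) := by ring
      _ = _ := by rw [he, mul_one, cutMatrix, Matrix.vecMulVec_apply]
  exact lt_irrefl (φ (cutMatrix (signVec s))) (hsub h)

theorem exists_unit_mul_of_cutMatrix_eq {n : ℕ} {s t : Fin n → ℤˣ}
    (h : cutMatrix (signVec s) = cutMatrix (signVec t)) : ∃ ε : ℤˣ, s = fun i => ε * t i := by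
  rcases n with _ | n
  · exact ⟨1, Subsingleton.elim _ _⟩
  refine ⟨s 0 * t 0, funext fun i => ?_⟩
  have h1 : s i * s 0 = t i * t 0 := by
    have := congrFun (congrFun h i) 0
    simp only [cutMatrix, Matrix.vecMulVec_apply, signVec] at this
    exact Units.ext (by push_cast; exact_mod_cast this)
  calc s i = s 0 * (s i * s 0) := by rw [mul_left_comm, Int.units_mul_self, mul_one]
    _ = _ := by rw [h1, mul_comm (t i), mul_assoc]

theorem cutMatrix_unit_mul {n : ℕ} (ε : ℤˣ) (s : Fin n → ℤˣ) :
    cutMatrix (signVec fun i => ε * s i) = cutMatrix (signVec s) := by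
  ext i j
  simp only [cutMatrix, Matrix.vecMulVec_apply, signVec, Units.val_mul, Int.cast_mul]
  rw [mul_mul_mul_comm, unit_mul_self_real, one_mul]

/-- A family in general position is determined by its cut hull up to order and signs. -/
theorem InGeneralPosition.exists_perm_of_cutHull_eq {r n : ℕ} {c c' : Fin r → Fin n → ℤˣ}
    (hc : InGeneralPosition c)
    (h : (cutHull fun k => signVec (c k)) = cutHull fun k => signVec (c' k)) :
    ∃ (σ : Equiv.Perm (Fin r)) (ε : Fin r → ℤˣ), c = fun k i => ε k * c' (σ k) i := by
  have h1 : ∀ k, ∃ (j : Fin r) (ε : ℤˣ), c k = fun i => ε * c' j i := by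
    intro k
    have hk : cutMatrix (signVec (c k)) ∈ cutHull fun k => signVec (c' k) := by
      rw [← h]
      exact subset_convexHull ℝ _ ⟨k, rfl⟩
    obtain ⟨j, hj⟩ := exists_cutMatrix_eq_of_mem_cutHull hk
    exact ⟨j, exists_unit_mul_of_cutMatrix_eq hj.symm⟩
  choose σ ε hσ using h1
  have hinj : Function.Injective σ := by
    intro k l hkl
    refine (linearIndependent_cutMatrix hc.linearIndependent).injective ?_
    rw [hσ k, hσ l, cutMatrix_unit_mul, cutMatrix_unit_mul, hkl]
  exact ⟨Equiv.ofBijective σ (Finite.injective_iff_bijective.1 hinj), ε, funext hσ⟩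

-- Each fibre of the map from families to hulls is covered by the `r!` permutations and `2^r` sign
-- changes of one member.
open Classical in
theorem card_inGeneralPosition_le {r : ℕ} (hr : 1 ≤ r) (n : ℕ) :
    (Finset.univ.filter fun c : Fin r → Fin n → ℤˣ => InGeneralPosition c).card ≤
      r.factorial * 2 ^ r * (sharedSimplicialFaces n (r - 1)).ncard := by
  rw [Set.ncard_eq_toFinset_card _ (finite_sharedSimplicialFaces n (r - 1))]
  refine Finset.card_le_mul_card_image_of_maps_to
    (f := fun c : Fin r → Fin n → ℤˣ => cutHull fun k => signVec (c k)) (fun c hc => ?_) _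
    fun F _ => ?_
  · rw [Set.Finite.mem_toFinset]
    exact (Finset.mem_filter.1 hc).2.mem_sharedSimplicialFaces hr
  · rcases Finset.eq_empty_or_nonempty (Finset.filter
      (fun c : Fin r → Fin n → ℤˣ => (cutHull fun k => signVec (c k)) = F)
      (Finset.univ.filter fun c : Fin r → Fin n → ℤˣ => InGeneralPosition c)) with he | ⟨c', hc'⟩
    · rw [he]
      simp
    · have hF := (Finset.mem_filter.1 hc').2
      refine (Finset.card_le_card (t := Finset.univ.image
        fun p : Equiv.Perm (Fin r) × (Fin r → ℤˣ) => fun k i => p.2 k * c' (p.1 k) i)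
        fun c hc => ?_).trans (Finset.card_image_le.trans ?_)
      · simp only [Finset.mem_filter, Finset.mem_univ, true_and] at hc
        obtain ⟨σ, ε, h⟩ := hc.1.exists_perm_of_cutHull_eq (hc.2.trans hF.symm)
        exact Finset.mem_image.2 ⟨(σ, ε), Finset.mem_univ _, h.symm⟩
      · simp [Fintype.card_perm]

/-! ### The law of the random family. -/

theorem signedBernoulli_singleton_unit (u : ℤˣ) :
    signedBernoulli (1 / 2) {((u : ℤ) : ℝ)} = 2⁻¹ := by
  have h2 : ENNReal.ofReal (2⁻¹ : ℝ) = 2⁻¹ := by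
    rw [ENNReal.ofReal_inv_of_pos (by norm_num)]
    simp
  rcases Int.units_eq_one_or u with rfl | rfl
  · simp [signedBernoulli, h2, show (-1 : ℝ) ≠ 1 by norm_num]
  · have : (1 - 2⁻¹ : ℝ) = 2⁻¹ := by norm_num
    simp [signedBernoulli, this, h2, show (1 : ℝ) ≠ -1 by norm_num]

instance isFiniteMeasure_signedBernoulli (p : ℝ) : IsFiniteMeasure (signedBernoulli p) := by
  constructor
  simp [signedBernoulli]

instance isFiniteMeasure_signedBernoulliVec (p : ℝ) (n : ℕ) :
    IsFiniteMeasure (signedBernoulliVec p n) := by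
  unfold signedBernoulliVec
  infer_instance

theorem signedBernoulliVec_singleton {n : ℕ} (s : Fin n → ℤˣ) :
    signedBernoulliVec (1 / 2) n {signVec s} = (2⁻¹) ^ n := by
  rw [signedBernoulliVec, Measure.pi_singleton]
  simp only [signVec, signedBernoulli_singleton_unit]
  simp

theorem IsFaceModel.map_eq {Ω : Type*} [MeasurableSpace Ω] {p : ℝ} {r n : ℕ} {μ : Measure Ω}
    [IsProbabilityMeasure μ] {ξ : Fin r → Ω → Fin n → ℝ} (h : IsFaceModel p r n μ ξ) :
    μ.map (fun ω k => ξ k ω) = Measure.pi fun _ => signedBernoulliVec p n := by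
  rw [(iIndepFun_iff_map_fun_eq_pi_map fun k => (h.hasLaw k).aemeasurable).1 h.indep]
  simp_rw [(h.hasLaw _).map_eq]

open Classical in
theorem IsFaceModel.card_inGeneralPosition_le {Ω : Type*} [MeasurableSpace Ω] {r n : ℕ}
    {μ : Measure Ω} [IsProbabilityMeasure μ] {ξ : Fin r → Ω → Fin n → ℝ}
    (h : IsFaceModel (1 / 2) r n μ ξ) :
    (Finset.univ.filter fun c : Fin r → Fin n → ℤˣ => InGeneralPosition c).card /
        ((2 : ℝ) ^ n) ^ r ≤
      μ.real {ω | ∃ c : Fin r → Fin n → ℤˣ, InGeneralPosition c ∧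
        (fun k => ξ k ω) = fun k => signVec (c k)} := by
  set G := Finset.univ.filter fun c : Fin r → Fin n → ℤˣ => InGeneralPosition c with hG
  have hinj : Function.Injective fun (c : Fin r → Fin n → ℤˣ) k => signVec (c k) :=
    fun c c' hcc => funext fun k => signVec_injective (congrFun hcc k)
  set T : Finset (Fin r → Fin n → ℝ) := G.image fun c k => signVec (c k) with hT
  -- As the preimage of a finite set, the event has probability equal to a sum of atoms, each of
  -- mass `2^(-nr)`.
  have hset : {ω | ∃ c : Fin r → Fin n → ℤˣ, InGeneralPosition c ∧
        (fun k => ξ k ω) = fun k => signVec (c k)} = (fun ω k => ξ k ω) ⁻¹' (T : Set _) := by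
    ext ω
    simp [hT, hG, eq_comm]
  have hξ : AEMeasurable (fun ω k => ξ k ω) μ :=
    aemeasurable_pi_lambda _ fun k => (h.hasLaw k).aemeasurable
  rw [hset, ← map_measureReal_apply_of_aemeasurable hξ T.measurableSet, h.map_eq,
    ← sum_measureReal_singleton, hT, Finset.sum_image hinj.injOn]
  have hc : ∀ c : Fin r → Fin n → ℤˣ, (Measure.pi fun _ : Fin r => signedBernoulliVec (1 / 2) n).real
      {fun k => signVec (c k)} = (((2 : ℝ) ^ n) ^ r)⁻¹ := by
    intro c
    rw [measureReal_def, Measure.pi_singleton]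
    simp_rw [signedBernoulliVec_singleton]
    simp
  simp_rw [hc]
  simp [div_eq_mul_inv]

/-! ### Numerical estimates. -/

theorem sq_mul_log_le {n r : ℕ} (hn : 2 ≤ n)
    (h : (r : ℝ) ≤ Real.sqrt ((n : ℝ) / Real.log n)) : (r : ℝ) ^ 2 * Real.log n ≤ n := by
  have hlog : 0 < Real.log n := Real.log_pos (by exact_mod_cast hn)
  have h1 := (Real.le_sqrt (Nat.cast_nonneg r) (by positivity)).1 h
  exact (le_div_iff₀ hlog).1 h1

theorem sq_mul_log_sq_lt {n r : ℕ} (hr : 1 ≤ r) (hn : 2 ≤ n)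
    (h : (r : ℝ) ^ 2 * Real.log n ≤ n) : (r : ℝ) ^ 2 * Real.log ((r : ℝ) ^ 2) < n := by
  have hn0 : (0 : ℝ) < n := by exact_mod_cast (by omega : 0 < n)
  rcases hr.eq_or_lt with rfl | hr'
  · simpa using hn0
  have hr0 : (0 : ℝ) < (r : ℝ) ^ 2 := by
    have : (0 : ℝ) < r := by exact_mod_cast hr
    positivity
  -- If `r² ≥ n`, then `log n ≤ 1`, which forces `n = 2`; but `r ≥ 2` and `4 log 2 > 2`.
  have hlt : (r : ℝ) ^ 2 < n := by
    by_contra! hle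
    have hlog : 0 < Real.log n := Real.log_pos (by exact_mod_cast hn)
    have h1 : Real.log n ≤ 1 := by
      have : (n : ℝ) * Real.log n ≤ n * 1 := by
        rw [mul_one]
        exact (mul_le_mul_of_nonneg_right hle hlog.le).trans h
      exact le_of_mul_le_mul_left this hn0
    have h2 : (n : ℝ) < 3 := by
      have h3 : (n : ℝ) ≤ Real.exp 1 := by
        rwa [← Real.log_le_iff_le_exp hn0]
      linarith [Real.exp_one_lt_d9]
    obtain rfl : n = 2 := by
      have : n < 3 := by exact_mod_cast h2
      omega
    have h4 : (4 : ℝ) ≤ (r : ℝ) ^ 2 := by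
      have : (2 : ℝ) ≤ r := by exact_mod_cast hr'
      nlinarith
    have h5 := Real.log_two_gt_d9
    push_cast at h
    nlinarith
  exact (mul_lt_mul_of_pos_left (Real.log_lt_log hr0 hlt) hr0).trans_le h

theorem mul_exp_neg_div_lt_one {x t : ℝ} (hx : 0 < x) (h : x * Real.log x < t) :
    x * Real.exp (-t / x) < 1 := by
  have h1 : Real.log x + -t / x < 0 := by
    rw [neg_div, ← sub_eq_add_neg, sub_neg, lt_div_iff₀ hx, mul_comm]
    exact h
  calc x * Real.exp (-t / x) = Real.exp (Real.log x + -t / x) := by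
        rw [Real.exp_add, Real.exp_log hx]
    _ < 1 := Real.exp_lt_one_iff.2 h1

/-- The hypothesis serves twice: `x ≤ n / log n` and `exp (-n/x) ≤ 1/n`. -/
theorem mul_exp_neg_div_le {n : ℕ} {x : ℝ} (hn : 2 ≤ n) (hx : 0 < x)
    (h : x * Real.log n ≤ n) : x * Real.exp (-(n : ℝ) / x) ≤ 1 / Real.log n := by
  have hlog : 0 < Real.log n := Real.log_pos (by exact_mod_cast hn)
  have hn0 : (0 : ℝ) < n := by exact_mod_cast (by omega : 0 < n)
  have h1 : Real.exp (-(n : ℝ) / x) ≤ Real.exp (-Real.log n) := by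
    rw [Real.exp_le_exp, neg_div, neg_le_neg_iff, le_div_iff₀ hx, mul_comm]
    exact h
  rw [Real.exp_neg, Real.exp_log hn0] at h1
  calc x * Real.exp (-(n : ℝ) / x) ≤ (n / Real.log n) * (n : ℝ)⁻¹ :=
        mul_le_mul ((le_div_iff₀ hlog).2 h) h1 (Real.exp_pos _).le (by positivity)
    _ = 1 / Real.log n := by field_simp

theorem theorem1 (n r : ℕ) (hr : 1 ≤ r) :
    -- the probability bounds for the random set `F = cutHull (ξ₁, …, ξ_r)`
    (∀ {Ω : Type*} [MeasurableSpace Ω] (μ : Measure Ω) [IsProbabilityMeasure μ]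
        (ξ : Fin r → Ω → Fin n → ℝ), IsFaceModel (1 / 2) r n μ ξ →
      1 - (r : ℝ) ^ 2 * Real.exp (-(n : ℝ) / (r : ℝ) ^ 2) ≤
          μ.real {ω | IsSimplicialFace (elliptope n) (cutHull fun i => ξ i ω) (r - 1)} ∧
      1 - (r : ℝ) ^ 2 * Real.exp (-(n : ℝ) / (r : ℝ) ^ 2) ≤
          μ.real {ω | (cutHull fun i => ξ i ω) ∈ sharedSimplicialFaces n (r - 1)} ∧
      ((r : ℝ) ^ 2 * Real.log ((r : ℝ) ^ 2) < n →
          0 < μ.real {ω | (cutHull fun i => ξ i ω) ∈ sharedSimplicialFaces n (r - 1)}) ∧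
      (2 ≤ n → (r : ℝ) ≤ Real.sqrt ((n : ℝ) / Real.log n) →
          0 < μ.real {ω | (cutHull fun i => ξ i ω) ∈ sharedSimplicialFaces n (r - 1)})) ∧
    -- the number of common simplicial faces of dimension `r - 1`
    (sharedSimplicialFaces n (r - 1)).Finite ∧
    (1 - (r : ℝ) ^ 2 * Real.exp (-(n : ℝ) / (r : ℝ) ^ 2)) *
        (((2 : ℝ) ^ n / 2) ^ r / (r.factorial : ℝ)) ≤
      ((sharedSimplicialFaces n (r - 1)).ncard : ℝ) ∧
    (2 ≤ n → (r : ℝ) ≤ Real.sqrt ((n : ℝ) / Real.log n) →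
      (1 - 1 / Real.log n) * (((2 : ℝ) ^ n / 2) ^ r / (r.factorial : ℝ)) ≤
        ((sharedSimplicialFaces n (r - 1)).ncard : ℝ)) := by
  
  have hr2 : (0 : ℝ) < (r : ℝ) ^ 2 := by
    have : (0 : ℝ) < r := by exact_mod_cast hr
    positivity
  have hcard := card_inGeneralPosition_ge hr n
  have hcount : (1 - (r : ℝ) ^ 2 * Real.exp (-(n : ℝ) / (r : ℝ) ^ 2)) *
        (((2 : ℝ) ^ n / 2) ^ r / (r.factorial : ℝ)) ≤
      ((sharedSimplicialFaces n (r - 1)).ncard : ℝ) := by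
    have h1 := card_inGeneralPosition_le hr n
    have h2 := hcard.trans (by exact_mod_cast h1 : _ ≤ ((r.factorial : ℝ) * 2 ^ r *
      (sharedSimplicialFaces n (r - 1)).ncard))
    have h3 : (0 : ℝ) < (r.factorial : ℝ) * 2 ^ r := by positivity
    rw [← mul_le_mul_iff_right₀ h3]
    refine le_of_eq_of_le ?_ h2
    -- The `2^r` sign choices account for `2^n / 2` in place of `2^n`.
    rw [div_pow]
    field_simp
  refine ⟨fun {Ω} _ μ _ ξ hξ => ?_, finite_sharedSimplicialFaces n (r - 1), hcount,
    fun hn hrn => ?_⟩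
  · have hG : 1 - (r : ℝ) ^ 2 * Real.exp (-(n : ℝ) / (r : ℝ) ^ 2) ≤
        μ.real {ω | ∃ c : Fin r → Fin n → ℤˣ, InGeneralPosition c ∧
          (fun k => ξ k ω) = fun k => signVec (c k)} := by
      refine le_trans ?_ hξ.card_inGeneralPosition_le
      rw [le_div_iff₀ (by positivity)]
      exact hcard
    have hshared : 1 - (r : ℝ) ^ 2 * Real.exp (-(n : ℝ) / (r : ℝ) ^ 2) ≤
        μ.real {ω | (cutHull fun i => ξ i ω) ∈ sharedSimplicialFaces n (r - 1)} := by
      -- Only monotonicity is used, so the event on the hull need not be measurable.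
      refine hG.trans (measureReal_mono ?_)
      rintro ω ⟨c, hc, h⟩
      rw [Set.mem_ofPred_eq, h]
      exact hc.mem_sharedSimplicialFaces hr
    have hpos : (r : ℝ) ^ 2 * Real.log ((r : ℝ) ^ 2) < n →
        0 < μ.real {ω | (cutHull fun i => ξ i ω) ∈ sharedSimplicialFaces n (r - 1)} :=
      fun h => (sub_pos.2 (mul_exp_neg_div_lt_one hr2 h)).trans_le hshared
    refine ⟨hshared.trans (measureReal_mono fun ω hω => hω.1), hshared, hpos,
      fun hn hrn => hpos (sq_mul_log_sq_lt hr hn (sq_mul_log_le hn hrn))⟩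
  · refine le_trans (mul_le_mul_of_nonneg_right ?_ (by positivity)) hcount
    have := mul_exp_neg_div_le hn hr2 (sq_mul_log_le hn hrn)
    linarith
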